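/- **Theorem (Strictly positive definite derivatives).** Let $(\Omega,\mathcal A,\mathbb P)$ be a probability space and let $\mathbf f_N=(\mathbf f_N(x))_{x\in\mathbb R^N}$ be a real-valued random function on $\mathbb R^N$, not necessarily Gaussian, with $\mathbb E[\mathbf f_N(x)^2]<\infty$ for all $x$. Assume that 1. $\mathbf f_N$ is stationary: for every $a\in\mathbb R^N$ the random functions $\mathbf f_N(\cdot+a)$ and $\mathbf f_N$ have the same law (on the space of all functions $\mathbb R^N\to\mathbb R$ with the product $\sigma$-algebra); 2. the covariance function $\mathcal C_{\mathbf f_N}(x,y)=\operatorname{Cov}(\mathbf f_N(x),\mathbf f_N(y))$ is continuous; 3. the support of the spectral measure $\sigma$ of $\mathbf f_N$, that is, of the finite Borel measure on $\mathbb R^N$ with $\mathcal C_{\mathbf f_N}(x,y)=\int e^{i\langle x-y,t\rangle}\,\sigma(dt)$ for all $x,y\in\mathbb R^N$, contains a non-empty open set. Let $k\ge 0$ be an integer such that almost surely the function $\mathbf f_N:\mathbb R^N\to\mathbb R$ is $k$ times (Fréchet) differentiable on all of $\mathbb R^N$ (the $k$-th derivative need not be continuous). Then the random function $$\mathbf g=\bigl(\mathbf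 f_N,\ \nabla\mathbf f_N,\ (\partial_{ij}\mathbf f_N)_{i\le j},\ \dots,\ (\partial_{i_1\cdots i_k}\mathbf f_N)_{i_1\le\dots\le i_k}\bigr):\mathbb R^N\to\mathbb R^m$$ is strictly positive definite: for all $n$, all distinct $x_1,\dots,x_n\in\mathbb R^N$ and all $w_1,\dots,w_n\in\mathbb R^m$, $$\mathbb V\Bigl[\sum_{j=1}^n w_j^T\mathbf g(x_j)\Bigr]=0\quad\Longrightarrow\quad w_1=\dots=w_n=0 .$$ Here the variance is taken in $[0,\infty]$, so that it vanishes exactly when the random variable is almost surely constant. -/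

import Mathlib

open MeasureTheory ProbabilityTheory

/-- `f` is (strictly) stationary: the law of the random function `x ↦ f x`, a measure on the space
of all functions with the product sigma-algebra, does not change when the input is translated. -/
def IsStationaryRandomFunction {Ω : Type*} [MeasurableSpace Ω] {N : ℕ}
    (f : EuclideanSpace ℝ (Fin N) → Ω → ℝ) (P : Measure Ω) : Prop :=
  ∀ a : EuclideanSpace ℝ (Fin N),
    IdentDistrib (fun ω x => f (x + a) ω) (fun ω x => f x ω) P P

/-- `σ` is the spectral measure of `f`: the finite Borel measure on `ℝ^N` with
`Cov (f x, f y) = ∫ exp (i ⟨x - y, t⟩) dσ(t)` for all `x`, `y`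
(`charFun σ z` is `∫ exp (i ⟨t, z⟩) dσ(t)`). -/
structure IsSpectralMeasure {Ω : Type*} [MeasurableSpace Ω] {N : ℕ}
    (σ : Measure (EuclideanSpace ℝ (Fin N)))
    (f : EuclideanSpace ℝ (Fin N) → Ω → ℝ) (P : Measure Ω) : Prop where
  finite : IsFiniteMeasure σ
  covariance_eq : ∀ x y : EuclideanSpace ℝ (Fin N),
    (cov[f x, f y; P] : ℂ) = charFun σ (x - y)

/-- `h` is `k` times (Fréchet) differentiable on all of `ℝ^N`; the `k`-th derivative need not be
continuous. -/
def TimesDifferentiable {N : ℕ} (k : ℕ) (h : EuclideanSpace ℝ (Fin N) → ℝ) : Prop :=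
  ∀ m < k, Differentiable ℝ (iteratedFDeriv ℝ m h)

/-- The partial derivative `∂_{i_1 ⋯ i_l} h (x)`. For `l = 0` this is `h x`. -/
noncomputable def partialDeriv {N l : ℕ} (i : Fin l → Fin N)
    (h : EuclideanSpace ℝ (Fin N) → ℝ) (x : EuclideanSpace ℝ (Fin N)) : ℝ :=
  iteratedFDeriv ℝ l h x (fun j => EuclideanSpace.single (i j) 1)

/-- The coordinates of the vector of all partial derivatives up to order `k`: an order `l ≤ k`
and indices `i_1 ≤ ⋯ ≤ i_l` in `{1, …, N}`. -/
abbrev DerivIndex (N k : ℕ) : Type :=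
  Σ l : Fin (k + 1), {i : Fin (l : ℕ) → Fin N // Monotone i}

noncomputable instance (N k : ℕ) : Fintype (DerivIndex N k) := Fintype.ofFinite _

/-- The random function `(f, ∇f, (∂_{ij} f)_{i ≤ j}, …, (∂_{i_1 ⋯ i_k} f)_{i_1 ≤ ⋯ ≤ i_k})`. -/
noncomputable def derivVector {Ω : Type*} {N : ℕ} (k : ℕ)
    (f : EuclideanSpace ℝ (Fin N) → Ω → ℝ)
    (x : EuclideanSpace ℝ (Fin N)) (ω : Ω) : DerivIndex N k → ℝ :=
  fun α => partialDeriv α.2.1 (fun y => f y ω) x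

/-- A random function `g` on `ℝ^N` with values in `ℝ^ι` is strictly positive definite: for
distinct points `x_1, …, x_n` the variance of `∑ j, w_jᵀ g (x_j)` vanishes only for `w = 0`.
The variance is taken in `[0, ∞]`, so it is zero only for an almost surely constant variable. -/
def StrictlyPositiveDefinite {Ω : Type*} [MeasurableSpace Ω] {N : ℕ} {ι : Type*} [Fintype ι]
    (g : EuclideanSpace ℝ (Fin N) → Ω → ι → ℝ) (P : Measure Ω) : Prop :=
  ∀ (n : ℕ) (x : Fin n → EuclideanSpace ℝ (Fin N)), Function.Injective x →
    ∀ w : Fin n → ι → ℝ,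
      evariance (fun ω => ∑ j, w j ⬝ᵥ g (x j) ω) P = 0 → ∀ j, w j = 0

/-! Suppose a combination `X = ∑ w_i ∂^{α_i} f(p_i)` is almost surely a constant `c`. By
stationarity the translated combination `X(a)` equals `c` almost surely for each `a`, and by Fubini
almost every path has `X(a) = c` for almost every `a`. Testing against a smooth compactly supported
`φ` and integrating by parts gives `∫ f ψ = c ∫ φ` almost surely, where `ψ(b) = ∑ w_i (D_i* φ)(b -
p_i)` involves no derivative of `f`. Taking the covariance with `f x` yields `∫ C(x, b) ψ(b) db = 0`
for all `x`; integrating this against `ψ(x)` gives `∫ |ψ̂|² dσ = 0`, so the continuous function `ψ̂`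
vanishes on the support of `σ`. Now `ψ̂ = Q φ̂` with `Q(t) = ∑ w_{jα} exp(i⟨x_j, t⟩) ∏ (i t_{α_l})`,
and `φ̂(t) ≠ 0` can be arranged at any given `t`. So `Q` vanishes on an open set, hence everywhere
by analyticity, and independence of exponentials and of monomials gives `w = 0`.

The delicate points are that derivatives of `f` need not have moments and that top-order derivatives
need be neither continuous nor locally integrable. Smoothing removes the first difficulty. For the
second, the whole top-order part of `X(a)` is almost everywhere equal to a continuous function,
which suffices for the divergence theorem (`integral_sum_fderiv_apply_eq_zero`,
`sum_integral_listDerivAdjoint_eq`). -/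

open Filter Topology

/-! ### Iterated directional derivatives as measurable functionals of the path -/

section ListDerivatives

open scoped ContDiff

variable {E : Type*} [NormedAddCommGroup E] [NormedSpace ℝ E]

/-- The iterated directional derivative along the vectors of a list; the head of the list is the
direction of the outermost derivative. -/
noncomputable def listDeriv : List E → (E → ℝ) → E → ℝ
  | [], h => h
  | v :: L, h => fun x => fderiv ℝ (listDeriv L h) x v

/-- The formal adjoint of `listDeriv`. -/
noncomputable def listDerivAdjoint : List E → (E → ℝ) → E → ℝ
  | [], φ => φ
  | v :: L, φ => listDerivAdjoint L fun x => -fderiv ℝ φ x v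

/-- The upper limit of the difference quotients of `g` along `v`, with step sizes `1 / (n + 1)`. -/
noncomputable def seqDeriv (v : E) (g : E → ℝ) (x : E) : ℝ :=
  limsup (fun n : ℕ => ((n : ℝ) + 1) * (g (x + ((n : ℝ) + 1)⁻¹ • v) - g x)) atTop

/-- The iteration of `seqDeriv` along the vectors of a list. -/
noncomputable def listSeqDeriv : List E → (E → ℝ) → E → ℝ
  | [], g => g
  | v :: L, g => seqDeriv v (listSeqDeriv L g)

theorem seqDeriv_eq_fderiv {g : E → ℝ} {x : E} (hg : DifferentiableAt ℝ g x) (v : E) :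
    seqDeriv v g x = fderiv ℝ g x v := by
  refine Tendsto.limsup_eq ?_
  have hc : Tendsto (fun n : ℕ => ‖(n : ℝ) + 1‖) atTop atTop := by
    refine tendsto_norm_atTop_atTop.comp ?_
    exact tendsto_atTop_add_const_right _ _ tendsto_natCast_atTop_atTop
  have h := hg.hasFDerivAt.lim v hc
  simpa [smul_eq_mul] using h

theorem listSeqDeriv_eq_listDeriv {k : ℕ} {h : E → ℝ}
    (hh : ∀ L : List E, L.length < k → Differentiable ℝ (listDeriv L h)) :
    ∀ L : List E, L.length ≤ k → listSeqDeriv L h = listDeriv L h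
  | [], _ => rfl
  | v :: L, hL => by
    have hL' : L.length < k := by simpa using hL
    funext x
    simp only [listSeqDeriv, listDeriv, listSeqDeriv_eq_listDeriv hh L hL'.le]
    exact seqDeriv_eq_fderiv (hh L hL' x) v

theorem seqDeriv_comp_add_right (v a : E) (g : E → ℝ) :
    seqDeriv v (fun x => g (x + a)) = fun x => seqDeriv v g (x + a) := by
  funext x
  simp only [seqDeriv, add_right_comm]

theorem listSeqDeriv_comp_add_right (a : E) (g : E → ℝ) : ∀ L : List E,
    listSeqDeriv L (fun x => g (x + a)) = fun x => listSeqDeriv L g (x + a)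
  | [] => rfl
  | v :: L => by
    simp only [listSeqDeriv, listSeqDeriv_comp_add_right a g L]
    exact seqDeriv_comp_add_right v a _

/-- A countable limsup of difference quotients is defined for every function and is measurable for
the product sigma-algebra. Stationarity, an equality of laws on that space, can therefore be applied
to derivatives. -/
theorem measurable_listSeqDeriv : ∀ L : List E, Measurable (listSeqDeriv (E := E) L)
  | [] => measurable_id
  | v :: L => by
    refine measurable_pi_lambda _ fun x => Measurable.limsup fun n => ?_
    have h := measurable_listSeqDeriv L
    exact measurable_const.mul
      (((measurable_pi_apply _).comp h).sub ((measurable_pi_apply _).comp h))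

theorem measurable_uncurry_listSeqDeriv [MeasurableSpace E] [BorelSpace E]
    [SecondCountableTopology E] {Ω : Type*} [MeasurableSpace Ω] {f : E → Ω → ℝ}
    (hf : Measurable (Function.uncurry f)) : ∀ L : List E,
    Measurable fun p : E × Ω => listSeqDeriv L (fun x => f x p.2) p.1
  | [] => hf
  | v :: L => by
    have h := measurable_uncurry_listSeqDeriv hf L
    refine Measurable.limsup fun n => measurable_const.mul (Measurable.sub ?_ h)
    exact h.comp ((measurable_fst.add_const _).prodMk measurable_snd)

theorem ContDiff.neg_fderiv_apply {φ : E → ℝ} (hφ : ContDiff ℝ ∞ φ) (v : E) :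
    ContDiff ℝ ∞ fun x => -fderiv ℝ φ x v :=
  ((hφ.fderiv_right (by simp)).clm_apply contDiff_const).neg

theorem HasCompactSupport.neg_fderiv_apply {φ : E → ℝ} (hφ : HasCompactSupport φ) (v : E) :
    HasCompactSupport fun x => -fderiv ℝ φ x v :=
  (hφ.fderiv_apply (𝕜 := ℝ) v).neg

theorem contDiff_listDerivAdjoint : ∀ (L : List E) {φ : E → ℝ}, ContDiff ℝ ∞ φ →
    ContDiff ℝ ∞ (listDerivAdjoint L φ)
  | [], _, h => h
  | v :: L, _, h => contDiff_listDerivAdjoint L (h.neg_fderiv_apply v)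

theorem hasCompactSupport_listDerivAdjoint : ∀ (L : List E) {φ : E → ℝ}, HasCompactSupport φ →
    HasCompactSupport (listDerivAdjoint L φ)
  | [], _, h => h
  | v :: L, _, h => hasCompactSupport_listDerivAdjoint L (h.neg_fderiv_apply v)

end ListDerivatives

/-! ### Partial derivatives as iterated directional derivatives -/

section PartialDerivatives

variable {N : ℕ}

theorem iteratedFDeriv_apply_eq_listDeriv {k : ℕ} {h : EuclideanSpace ℝ (Fin N) → ℝ}
    (hh : TimesDifferentiable k h) : ∀ {l : ℕ} (v : Fin l → EuclideanSpace ℝ (Fin N)), l ≤ k →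
    (fun x => iteratedFDeriv ℝ l h x v) = listDeriv (List.ofFn v) h
  | 0, v, _ => by
    funext x
    simp [listDeriv]
  | l + 1, v, hl => by
    have ih := iteratedFDeriv_apply_eq_listDeriv hh (Fin.tail v) (Nat.le_of_succ_le hl)
    funext x
    rw [List.ofFn_succ]
    change _ = fderiv ℝ (listDeriv (List.ofFn (Fin.tail v)) h) x _
    rw [← ih, fderiv_continuousMultilinear_apply_const (hh l hl x),
      iteratedFDeriv_succ_apply_left]
    rfl

theorem TimesDifferentiable.differentiable_listDeriv {k : ℕ} {h : EuclideanSpace ℝ (Fin N) → ℝ}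
    (hh : TimesDifferentiable k h) (L : List (EuclideanSpace ℝ (Fin N))) (hL : L.length < k) :
    Differentiable ℝ (listDeriv L h) := by
  have h1 := iteratedFDeriv_apply_eq_listDeriv hh L.get hL.le
  rw [List.ofFn_get] at h1
  rw [← h1]
  exact fun x => ((hh _ hL x).hasFDerivAt.continuousMultilinear_apply_const _).differentiableAt

end PartialDerivatives

/-! ### Integration by parts without continuity of the top derivatives -/

section IntegrationByParts

open scoped ContDiff

variable {N : ℕ}

/-- The divergence theorem for everywhere differentiable, compactly supported vector fields with
integrable divergence: here the field is `∑ i ∈ s, u i • v i`. -/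
theorem integral_sum_fderiv_apply_eq_zero {ι : Type*} (s : Finset ι)
    (u : ι → EuclideanSpace ℝ (Fin N) → ℝ) (v : ι → EuclideanSpace ℝ (Fin N))
    (hu : ∀ i ∈ s, Differentiable ℝ (u i)) (hc : ∀ i ∈ s, HasCompactSupport (u i))
    (hint : Integrable fun x => ∑ i ∈ s, fderiv ℝ (u i) x (v i)) :
    ∫ x, ∑ i ∈ s, fderiv ℝ (u i) x (v i) = 0 := by
  obtain _ | n := N
  · have hv : ∀ i, v i = 0 := fun i => Subsingleton.elim _ _
    simp [hv]
  classical
  let e := (EuclideanSpace.equiv (Fin (n + 1)) ℝ).symm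
  have hmp : MeasurePreserving e := PiLp.volume_preserving_toLp (Fin (n + 1))
  have hemb : MeasurableEmbedding e := e.toHomeomorph.measurableEmbedding
  let F : Fin (n + 1) → (Fin (n + 1) → ℝ) → ℝ := fun j y => ∑ i ∈ s, u i (e y) * v i j
  let F' : Fin (n + 1) → (Fin (n + 1) → ℝ) → (Fin (n + 1) → ℝ) →L[ℝ] ℝ := fun j y =>
    ∑ i ∈ s, (v i j) • (fderiv ℝ (u i) (e y)).comp (e : (Fin (n + 1) → ℝ) →L[ℝ] _)
  have hF : ∀ j y, HasFDerivAt (F j) (F' j y) y := fun j y => by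
    refine HasFDerivAt.fun_sum fun i hi => ?_
    exact ((hu i hi (e y)).hasFDerivAt.comp y e.hasFDerivAt).mul_const (v i j)
  have hdiv : ∀ y, ∑ j, F' j y (Pi.single j 1) = ∑ i ∈ s, fderiv ℝ (u i) (e y) (v i) := by
    intro y
    simp only [F', sum_apply]
    rw [Finset.sum_comm]
    refine Finset.sum_congr rfl fun i _ => ?_
    have hvi : v i = ∑ j, v i j • e (Pi.single j 1) := by
      simp_rw [← map_smul, ← map_sum]
      rw [← pi_eq_sum_univ']
      rfl
    conv_rhs => rw [hvi]
    simp
  obtain ⟨R, hR, hRs⟩ : ∃ R : ℝ, 0 < R ∧ ∀ i ∈ s, ∀ y : Fin (n + 1) → ℝ,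
      R ≤ ‖y‖ → u i (e y) = 0 := by
    have hK : IsCompact (⋃ i ∈ s, e ⁻¹' tsupport (u i)) :=
      s.isCompact_biUnion fun i hi => e.toHomeomorph.isCompact_preimage.2 (hc i hi)
    obtain ⟨R, hR, hRs⟩ := hK.isBounded.subset_ball_lt 0 0
    refine ⟨R, hR, fun i hi y hy => ?_⟩
    by_contra h
    have : y ∈ Metric.ball (0 : Fin (n + 1) → ℝ) R :=
      hRs (Set.mem_biUnion hi (subset_tsupport _ h))
    rw [mem_ball_zero_iff] at this
    exact absurd hy (not_le.2 this)
  have hF0 : ∀ j y, R ≤ ‖y‖ → F j y = 0 := fun j y hy =>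
    Finset.sum_eq_zero fun i hi => by rw [hRs i hi y hy, zero_mul]
  have hint' : Integrable fun y => ∑ j, F' j y (Pi.single j 1) := by
    simp_rw [hdiv]
    exact (hmp.integrable_comp_emb hemb).2 hint
  -- This form of the divergence theorem needs pointwise differentiability and integrability of the
  -- total divergence only, not of its separate terms. The field vanishes on the faces of the box.
  have key := integral_divergence_of_hasFDerivAt_off_countable' (fun _ => -R) (fun _ => R)
    (fun _ => by simp only; linarith) F F' ∅ Set.countable_empty
    (fun j y _ => (hF j y).continuousAt.continuousWithinAt)
    (fun y _ j => hF j y) hint'.integrableOn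
  have hface : ∀ (j : Fin (n + 1)) (c : ℝ) (y : Fin n → ℝ), R ≤ |c| → F j (j.insertNth c y) = 0 := by
    intro j c y hcR
    refine hF0 j _ (hcR.trans ?_)
    have := norm_le_pi_norm (j.insertNth c y : Fin (n + 1) → ℝ) j
    simpa using this
  have hz : ∀ j (y : Fin n → ℝ), F j (j.insertNth R y) = 0 ∧ F j (j.insertNth (-R) y) = 0 :=
    fun j y => ⟨hface j _ y (le_abs_self R), hface j _ y (by rw [abs_neg]; exact le_abs_self R)⟩
  simp only [hz, integral_zero, sub_self, Finset.sum_const_zero] at key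
  rw [← hmp.integral_comp hemb]
  simp_rw [← hdiv]
  rw [← key, setIntegral_eq_integral_of_ae_compl_eq_zero]
  refine ae_of_all _ fun y hy => ?_
  rw [hdiv]
  refine Finset.sum_eq_zero fun i hi => ?_
  have hopen : ∀ᶠ z in 𝓝 y, z ∉ Set.Icc (fun _ : Fin (n + 1) => -R) (fun _ => R) :=
    isClosed_Icc.isOpen_compl.mem_nhds hy
  have hev : u i =ᶠ[𝓝 (e y)] fun _ => 0 := by
    have h1 : ∀ᶠ z in 𝓝 y, u i (e z) = 0 := by
      filter_upwards [hopen] with z hz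
      refine hRs i hi z ?_
      by_contra hlt
      refine hz ⟨fun j => ?_, fun j => ?_⟩
      all_goals
        have := abs_le.1 ((norm_le_pi_norm z j).trans (not_le.1 hlt).le)
        linarith [this.1, this.2]
    have h2 := (e.symm.continuous.tendsto (e y)).eventually
      (by rw [e.symm_apply_apply]; exact h1)
    filter_upwards [h2] with x hx
    simpa using hx
  rw [hev.fderiv_eq]
  simp

/-- Integration by parts for everywhere differentiable functions, only a combination of whose
derivatives is required to be continuous. -/
theorem integral_mul_eq_sum_of_sum_fderiv_ae_eq {ι : Type*} (s : Finset ι)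
    (u : ι → EuclideanSpace ℝ (Fin N) → ℝ) (v : ι → EuclideanSpace ℝ (Fin N))
    (hu : ∀ i ∈ s, Differentiable ℝ (u i)) {G : EuclideanSpace ℝ (Fin N) → ℝ} (hG : Continuous G)
    (huG : ∀ᵐ x, ∑ i ∈ s, fderiv ℝ (u i) x (v i) = G x)
    {φ : EuclideanSpace ℝ (Fin N) → ℝ} (hφ : ContDiff ℝ ∞ φ) (hφc : HasCompactSupport φ) :
    ∫ x, G x * φ x = ∑ i ∈ s, ∫ x, u i x * -fderiv ℝ φ x (v i) := by
  have hφd : Differentiable ℝ φ := hφ.differentiable (by simp)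
  have hφ' : ∀ w, Continuous fun x => fderiv ℝ φ x w := fun w =>
    (hφ.continuous_fderiv (by simp)).clm_apply continuous_const
  have hI1 : Integrable fun x => G x * φ x :=
    (hG.mul hφ.continuous).integrable_of_hasCompactSupport hφc.mul_left
  have hI2 : ∀ i ∈ s, Integrable fun x => u i x * fderiv ℝ φ x (v i) := fun i hi =>
    ((hu i hi).continuous.mul (hφ' _)).integrable_of_hasCompactSupport
      (hφc.fderiv_apply (𝕜 := ℝ) (v i)).mul_left
  have hfd : ∀ i ∈ s, ∀ x, fderiv ℝ (fun y => u i y * φ y) x (v i) =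
      u i x * fderiv ℝ φ x (v i) + fderiv ℝ (u i) x (v i) * φ x := fun i hi x => by
    rw [fderiv_fun_mul (hu i hi x) (hφd x)]
    simp [mul_comm]
  have hae : (fun x => ∑ i ∈ s, fderiv ℝ (fun y => u i y * φ y) x (v i)) =ᵐ[volume]
      fun x => G x * φ x + ∑ i ∈ s, u i x * fderiv ℝ φ x (v i) := by
    filter_upwards [huG] with x hx
    rw [Finset.sum_congr rfl fun i hi => hfd i hi x, Finset.sum_add_distrib, ← Finset.sum_mul, hx,
      add_comm]
  have h0 := integral_sum_fderiv_apply_eq_zero s (fun i y => u i y * φ y) v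
    (fun i hi => (hu i hi).mul hφd) (fun i hi => hφc.mul_left)
    ((hI1.add (integrable_finsetSum _ hI2)).congr hae.symm)
  rw [integral_congr_ae hae, integral_add hI1 (integrable_finsetSum _ hI2),
    integral_finsetSum _ hI2] at h0
  simp only [mul_neg, integral_neg, Finset.sum_neg_distrib]
  linarith

/-- Below order `k` each derivative is itself differentiable, hence continuous, so it can be
integrated by parts on its own. -/
theorem integral_listDeriv_mul {k : ℕ} {h : EuclideanSpace ℝ (Fin N) → ℝ}
    (hh : TimesDifferentiable k h) (a : EuclideanSpace ℝ (Fin N)) :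
    ∀ (L : List (EuclideanSpace ℝ (Fin N))), L.length < k →
    ∀ {φ : EuclideanSpace ℝ (Fin N) → ℝ}, ContDiff ℝ ∞ φ → HasCompactSupport φ →
    ∫ x, listDeriv L h (x + a) * φ x = ∫ x, h (x + a) * listDerivAdjoint L φ x
  | [], _, _, _, _ => rfl
  | v :: L, hL, φ, hφ, hφc => by
    have hL' : L.length < k := by simp at hL; omega
    have hd := hh.differentiable_listDeriv L hL'
    have hu : Differentiable ℝ fun x => listDeriv L h (x + a) :=
      hd.comp (differentiable_id.add_const a)
    have h1 := integral_mul_eq_sum_of_sum_fderiv_ae_eq ({()} : Finset Unit)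
      (fun _ x => listDeriv L h (x + a)) (fun _ => v) (fun _ _ => hu)
      (G := fun x => listDeriv (v :: L) h (x + a))
      ((hh.differentiable_listDeriv _ hL).continuous.comp (continuous_add_const a))
      (ae_of_all _ fun x => by simp [listDeriv, fderiv_comp_add_right]) hφ hφc
    rw [h1, Finset.sum_singleton]
    exact integral_listDeriv_mul hh a L hL' (hφ.neg_fderiv_apply v) (hφc.neg_fderiv_apply v)

/-- If a linear combination of translated partial derivatives of order at most `k` of a `k` times
differentiable function is constant almost everywhere, then so it is as a distribution. -/
theorem sum_integral_listDerivAdjoint_eq {k : ℕ} (hk : k ≠ 0)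
    {h : EuclideanSpace ℝ (Fin N) → ℝ} (hh : TimesDifferentiable k h)
    {ι : Type*} [Fintype ι] (w : ι → ℝ) (p : ι → EuclideanSpace ℝ (Fin N))
    (L : ι → List (EuclideanSpace ℝ (Fin N))) (hL : ∀ i, (L i).length ≤ k) {c : ℝ}
    (hc : ∀ᵐ x, ∑ i, w i * listDeriv (L i) h (x + p i) = c)
    {φ : EuclideanSpace ℝ (Fin N) → ℝ} (hφ : ContDiff ℝ ∞ φ) (hφc : HasCompactSupport φ) :
    ∑ i, w i * ∫ x, h (x + p i) * listDerivAdjoint (L i) φ x = c * ∫ x, φ x := by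
  classical
  -- The terms of exact order `k` go into `s` and must be treated together: individually they may
  -- fail to be integrable, but their sum is almost everywhere `c` minus the continuous terms in
  -- `t`.
  set s : Finset ι := Finset.univ.filter fun i => (L i).length = k with hs
  set t : Finset ι := Finset.univ.filter fun i => ¬ (L i).length = k with ht
  have hcons : ∀ i ∈ s, L i = (L i).headD 0 :: (L i).tail := fun i hi => by
    have : (L i).length = k := (Finset.mem_filter.1 hi).2
    cases hLi : L i with
    | nil => simp [hLi] at this; omega
    | cons v M => rfl
  have htail : ∀ i ∈ s, (L i).tail.length < k := fun i hi => by
    have : (L i).length = k := (Finset.mem_filter.1 hi).2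
    rw [List.length_tail]
    omega
  have hlt : ∀ i ∈ t, (L i).length < k := fun i hi =>
    lt_of_le_of_ne (hL i) (Finset.mem_filter.1 hi).2
  have hcont : ∀ i ∈ t, Continuous fun x => listDeriv (L i) h (x + p i) := fun i hi =>
    (hh.differentiable_listDeriv _ (hlt i hi)).continuous.comp (continuous_add_const _)
  have hsplit : ∀ g : ι → ℝ, ∑ i, g i = ∑ i ∈ s, g i + ∑ i ∈ t, g i := fun g =>
    (Finset.sum_filter_add_sum_filter_not _ _ _).symm
  have hIt : ∀ i ∈ t, Integrable fun x => w i * listDeriv (L i) h (x + p i) * φ x := fun i hi =>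
    ((continuous_const.mul (hcont i hi)).mul hφ.continuous).integrable_of_hasCompactSupport
      hφc.mul_left
  have hIφ : Integrable fun x => c * φ x :=
    (hφ.continuous.integrable_of_hasCompactSupport hφc).const_mul c
  have hu : ∀ i ∈ s, Differentiable ℝ fun x => listDeriv (L i).tail h (x + p i) := fun i hi =>
    (hh.differentiable_listDeriv _ (htail i hi)).comp (differentiable_id.add_const _)
  have h1 := integral_mul_eq_sum_of_sum_fderiv_ae_eq s
    (fun i x => w i * listDeriv (L i).tail h (x + p i)) (fun i => (L i).headD 0)
    (fun i hi => (hu i hi).const_mul _)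
    (G := fun x => c - ∑ i ∈ t, w i * listDeriv (L i) h (x + p i))
    (continuous_const.sub (continuous_finsetSum _ fun i hi => continuous_const.mul (hcont i hi)))
    (by
      filter_upwards [hc] with x hx
      rw [hsplit] at hx
      rw [← hx, add_sub_cancel_right]
      refine Finset.sum_congr rfl fun i hi => ?_
      rw [fderiv_const_mul (hu i hi x)]
      conv_rhs => rw [hcons i hi]
      simp [listDeriv, fderiv_comp_add_right]) hφ hφc
  have h2 : ∀ i ∈ s, ∫ x, w i * listDeriv (L i).tail h (x + p i) *
      -fderiv ℝ φ x ((L i).headD 0) = w i * ∫ x, h (x + p i) * listDerivAdjoint (L i) φ x := by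
    intro i hi
    simp only [mul_assoc]
    rw [integral_const_mul, integral_listDeriv_mul hh (p i) _ (htail i hi)
      (hφ.neg_fderiv_apply _) (hφc.neg_fderiv_apply _)]
    conv_rhs => rw [hcons i hi]
    rfl
  have h3 : ∀ i ∈ t, ∫ x, w i * listDeriv (L i) h (x + p i) * φ x =
      w i * ∫ x, h (x + p i) * listDerivAdjoint (L i) φ x := by
    intro i hi
    simp only [mul_assoc]
    rw [integral_const_mul, integral_listDeriv_mul hh (p i) _ (hlt i hi) hφ hφc]
  rw [Finset.sum_congr rfl h2] at h1
  simp only [sub_mul, Finset.sum_mul] at h1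
  rw [integral_sub hIφ (integrable_finsetSum _ hIt), integral_finsetSum _ hIt,
    Finset.sum_congr rfl h3, integral_const_mul] at h1
  rw [hsplit]
  linarith

end IntegrationByParts

/-! ### Fourier integrals and the support of the spectral measure -/

section FourierSide

open scoped ContDiff

variable {N : ℕ}

/-- The Fourier integral `∫ exp (i ⟨b, t⟩) ψ(b) db`. -/
noncomputable def fourierInt (ψ : EuclideanSpace ℝ (Fin N) → ℝ) (t : EuclideanSpace ℝ (Fin N)) :
    ℂ :=
  ∫ b, Complex.exp ((inner ℝ b t : ℝ) * Complex.I) * (ψ b : ℂ)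

theorem integral_integral_swap_of_bounded {σ : Measure (EuclideanSpace ℝ (Fin N))}
    [IsFiniteMeasure σ] {ψ : EuclideanSpace ℝ (Fin N) → ℝ} (hψ : Integrable ψ)
    {g : EuclideanSpace ℝ (Fin N) → EuclideanSpace ℝ (Fin N) → ℂ}
    (hg : Continuous (Function.uncurry g)) (C : ℝ) (hC : ∀ b t, ‖g b t‖ ≤ C) :
    ∫ b, (∫ t, g b t ∂σ) * (ψ b : ℂ) = ∫ t, (∫ b, g b t * (ψ b : ℂ)) ∂σ := by
  simp_rw [← integral_mul_const]
  refine integral_integral_swap ?_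
  have h1 : Integrable (fun p : EuclideanSpace ℝ (Fin N) × EuclideanSpace ℝ (Fin N) =>
      (ψ p.1 : ℂ) * (1 : ℂ)) (volume.prod σ) :=
    Integrable.mul_prod (f := fun b => (ψ b : ℂ)) (g := fun _ => (1 : ℂ)) hψ.ofReal
      (integrable_const 1)
  have h2 := h1.bdd_mul (c := C) hg.aestronglyMeasurable (ae_of_all _ fun p => hC p.1 p.2)
  simpa [Function.uncurry_def] using h2

theorem norm_exp_inner_mul_I (b t : EuclideanSpace ℝ (Fin N)) :
    ‖Complex.exp ((inner ℝ b t : ℝ) * Complex.I)‖ = 1 :=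
  Complex.norm_exp_ofReal_mul_I _

theorem norm_fourierInt_le (ψ : EuclideanSpace ℝ (Fin N) → ℝ) (t : EuclideanSpace ℝ (Fin N)) :
    ‖fourierInt ψ t‖ ≤ ∫ b, ‖ψ b‖ := by
  refine (norm_integral_le_integral_norm _).trans (le_of_eq ?_)
  simp [Complex.norm_exp_ofReal_mul_I]

theorem continuous_fourierInt {ψ : EuclideanSpace ℝ (Fin N) → ℝ} (hψ : Integrable ψ) :
    Continuous (fourierInt ψ) := by
  refine continuous_of_dominated (bound := fun b => ‖ψ b‖) (fun t => ?_) (fun t => ?_) hψ.norm ?_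
  · exact (Continuous.aestronglyMeasurable (by fun_prop)).mul hψ.ofReal.aestronglyMeasurable
  · refine ae_of_all _ fun b => ?_
    rw [norm_mul, norm_exp_inner_mul_I]
    simp
  · exact ae_of_all _ fun b => by fun_prop

theorem conj_fourierInt (ψ : EuclideanSpace ℝ (Fin N) → ℝ) (t : EuclideanSpace ℝ (Fin N)) :
    (starRingEnd ℂ) (fourierInt ψ t) =
      ∫ b, Complex.exp (-(inner ℝ b t : ℝ) * Complex.I) * (ψ b : ℂ) := by
  rw [fourierInt, ← integral_conj]
  refine integral_congr_ae (ae_of_all _ fun b => ?_)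
  simp [← Complex.exp_conj]

/-- If a function is orthogonal to all translates of a positive definite function, then its Fourier
integral vanishes on the support of the spectral measure. -/
theorem fourierInt_eq_zero_of_mem_support {σ : Measure (EuclideanSpace ℝ (Fin N))}
    [IsFiniteMeasure σ] {ψ : EuclideanSpace ℝ (Fin N) → ℝ} (hψ : Integrable ψ)
    (h0 : ∀ x, ∫ b, charFun σ (x - b) * (ψ b : ℂ) = 0) :
    ∀ t ∈ σ.support, fourierInt ψ t = 0 := by
  -- By Fubini the hypothesis says that the complex measure with density the conjugate of
  -- `fourierInt ψ` with respect to `σ` has zero Fourier transform. Integrating this against `ψ x`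
  -- then produces `∫ ‖fourierInt ψ‖² dσ = 0`.
  have h1 : ∀ x, ∫ t, Complex.exp ((inner ℝ x t : ℝ) * Complex.I) *
      (starRingEnd ℂ) (fourierInt ψ t) ∂σ = 0 := by
    intro x
    have h2 := integral_integral_swap_of_bounded (σ := σ) hψ
      (g := fun b t => Complex.exp ((inner ℝ t (x - b) : ℝ) * Complex.I))
      (by fun_prop) 1 (fun b t => (norm_exp_inner_mul_I _ _).le)
    simp_rw [charFun_apply] at h0
    rw [h0 x] at h2
    rw [h2]
    refine integral_congr_ae (ae_of_all _ fun t => ?_)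
    simp only [conj_fourierInt]
    rw [← integral_const_mul]
    refine integral_congr_ae (ae_of_all _ fun b => ?_)
    simp only
    rw [← mul_assoc, ← Complex.exp_add, inner_sub_right, real_inner_comm x t, real_inner_comm b t]
    congr 2
    push_cast
    ring
  have hK := continuous_fourierInt hψ
  have h3 := integral_integral_swap_of_bounded (σ := σ) hψ
    (g := fun b t => Complex.exp ((inner ℝ b t : ℝ) * Complex.I) *
      (starRingEnd ℂ) (fourierInt ψ t))
    (by
      refine Continuous.mul (by fun_prop) ?_
      exact Complex.continuous_conj.comp (hK.comp continuous_snd)) (∫ b, ‖ψ b‖)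
    (fun b t => by
      rw [norm_mul, norm_exp_inner_mul_I, one_mul, RCLike.norm_conj]
      exact norm_fourierInt_le ψ t)
  simp only [h1, zero_mul, integral_zero] at h3
  have h4 : ∀ t, ∫ b, Complex.exp ((inner ℝ b t : ℝ) * Complex.I) *
      (starRingEnd ℂ) (fourierInt ψ t) * (ψ b : ℂ) = ((‖fourierInt ψ t‖ ^ 2 : ℝ) : ℂ) := by
    intro t
    simp_rw [mul_right_comm]
    rw [integral_mul_const, ← fourierInt, Complex.mul_conj, Complex.normSq_eq_norm_sq]
  simp_rw [h4, integral_complex_ofReal] at h3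
  have h5 : ∫ t, ‖fourierInt ψ t‖ ^ 2 ∂σ = 0 := by exact_mod_cast h3.symm
  have hI : Integrable (fun t => ‖fourierInt ψ t‖ ^ 2) σ :=
    Integrable.of_bound (hK.norm.pow 2).aestronglyMeasurable ((∫ b, ‖ψ b‖) ^ 2)
      (ae_of_all _ fun t => by
        rw [norm_pow, norm_norm]
        gcongr
        exact norm_fourierInt_le ψ t)
  rw [integral_eq_zero_iff_of_nonneg (fun t => by positivity) hI] at h5
  have hopen : IsOpen {t | fourierInt ψ t ≠ 0} := isOpen_ne_fun hK continuous_const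
  have hnull : σ {t | fourierInt ψ t ≠ 0} = 0 := by
    refine measure_mono_null ?_ h5
    intro t ht
    simpa using ht
  intro t ht
  by_contra h
  exact Measure.subset_compl_support_of_isOpen hopen hnull h ht

theorem fourierInt_neg_fderiv_apply {φ : EuclideanSpace ℝ (Fin N) → ℝ} (hφ : ContDiff ℝ ∞ φ)
    (hφc : HasCompactSupport φ) (v t : EuclideanSpace ℝ (Fin N)) :
    fourierInt (fun x => -fderiv ℝ φ x v) t = ((inner ℝ v t : ℝ) * Complex.I) * fourierInt φ t := by
  let e : EuclideanSpace ℝ (Fin N) → ℂ := fun b => Complex.exp ((inner ℝ b t : ℝ) * Complex.I)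
  have he : ∀ b, HasFDerivAt e (e b • ((Complex.ofRealCLM.comp (innerSL ℝ t)).smulRight Complex.I))
      b := by
    intro b
    have h1 : HasFDerivAt (fun b => ((inner ℝ b t : ℝ) : ℂ) * Complex.I)
        ((Complex.ofRealCLM.comp (innerSL ℝ t)).smulRight Complex.I) b := by
      have := ((Complex.ofRealCLM.comp (innerSL ℝ t)).smulRight Complex.I).hasFDerivAt (x := b)
      refine this.congr_of_eventuallyEq (Eventually.of_forall fun y => ?_)
      simp [real_inner_comm]
    exact h1.cexp
  have hed : ∀ b, fderiv ℝ e b v = (inner ℝ v t : ℝ) * Complex.I * e b := by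
    intro b
    rw [(he b).fderiv]
    simp [real_inner_comm]
    ring
  have hec : Continuous e := by fun_prop
  let Φ : EuclideanSpace ℝ (Fin N) → ℂ := fun b => (φ b : ℂ)
  have hφd : ∀ b, HasFDerivAt Φ (Complex.ofRealCLM.comp (fderiv ℝ φ b)) b := fun b =>
    Complex.ofRealCLM.hasFDerivAt.comp b ((hφ.differentiable (by simp)) b).hasFDerivAt
  have hΦd : ∀ b, fderiv ℝ Φ b v = (fderiv ℝ φ b v : ℂ) := fun b => by
    rw [(hφd b).fderiv]
    simp
  have hφ' : Continuous fun x => fderiv ℝ φ x v :=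
    (hφ.continuous_fderiv (by simp)).clm_apply continuous_const
  have hΦc : HasCompactSupport Φ := hφc.comp_left Complex.ofReal_zero
  have hΦ'c : HasCompactSupport fun b => ((fderiv ℝ φ b v : ℝ) : ℂ) :=
    (hφc.fderiv_apply (𝕜 := ℝ) v).comp_left Complex.ofReal_zero
  have hΦ : Continuous Φ := Complex.continuous_ofReal.comp hφ.continuous
  have key := integral_mul_fderiv_eq_neg_fderiv_mul_of_integrable (μ := volume) (f := e) (g := Φ)
    (v := v)
    (by
      simp_rw [hed]
      exact ((continuous_const.mul hec).mul hΦ).integrable_of_hasCompactSupport hΦc.mul_left)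
    (by
      simp_rw [hΦd]
      exact (hec.mul (Complex.continuous_ofReal.comp hφ')).integrable_of_hasCompactSupport
        hΦ'c.mul_left)
    ((hec.mul hΦ).integrable_of_hasCompactSupport hΦc.mul_left)
    (fun b _ => (he b).differentiableAt) (fun b _ => (hφd b).differentiableAt)
  simp_rw [hed, hΦd, mul_assoc, integral_const_mul] at key
  simp only [fourierInt, Complex.ofReal_neg, mul_neg, integral_neg]
  change -∫ b, e b * _ = _
  rw [key, neg_neg, mul_assoc]

theorem fourierInt_listDerivAdjoint (t : EuclideanSpace ℝ (Fin N)) :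
    ∀ (L : List (EuclideanSpace ℝ (Fin N))) {φ : EuclideanSpace ℝ (Fin N) → ℝ},
    ContDiff ℝ ∞ φ → HasCompactSupport φ → fourierInt (listDerivAdjoint L φ) t =
      (L.map fun v => ((inner ℝ v t : ℝ) : ℂ) * Complex.I).prod * fourierInt φ t
  | [], _, _, _ => by simp [listDerivAdjoint]
  | v :: L, φ, hφ, hφc => by
    rw [listDerivAdjoint, fourierInt_listDerivAdjoint t L (hφ.neg_fderiv_apply v)
      (hφc.neg_fderiv_apply v), fourierInt_neg_fderiv_apply hφ hφc, List.map_cons, List.prod_cons]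
    ring

theorem fourierInt_comp_sub_right (ψ : EuclideanSpace ℝ (Fin N) → ℝ)
    (p t : EuclideanSpace ℝ (Fin N)) : fourierInt (fun x => ψ (x - p)) t =
      Complex.exp ((inner ℝ p t : ℝ) * Complex.I) * fourierInt ψ t := by
  rw [fourierInt, ← integral_add_right_eq_self _ p, fourierInt, ← integral_const_mul]
  refine integral_congr_ae (ae_of_all _ fun b => ?_)
  simp only [add_sub_cancel_right]
  rw [← mul_assoc, ← Complex.exp_add, inner_add_left]
  congr 2
  push_cast
  ring

/-- A bump supported in the ball of radius `1 / (‖t₀‖ + 1)` only sees phases `|⟨b, t₀⟩| ≤ 1 < π /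
2`, where the cosine is positive; so the real part of the integral is positive. -/
theorem exists_fourierInt_ne_zero (t₀ : EuclideanSpace ℝ (Fin N)) :
    ∃ φ : EuclideanSpace ℝ (Fin N) → ℝ, ContDiff ℝ ∞ φ ∧ HasCompactSupport φ ∧
      fourierInt φ t₀ ≠ 0 := by
  have hr : 0 < (‖t₀‖ + 1)⁻¹ := by positivity
  let B : ContDiffBump (0 : EuclideanSpace ℝ (Fin N)) :=
    ⟨(‖t₀‖ + 1)⁻¹ / 2, (‖t₀‖ + 1)⁻¹, by positivity, by linarith⟩
  refine ⟨B, B.contDiff, B.hasCompactSupport, fun h => ?_⟩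
  have hI : Integrable fun b => Complex.exp ((inner ℝ b t₀ : ℝ) * Complex.I) * (B b : ℂ) :=
    Continuous.integrable_of_hasCompactSupport
      (Continuous.mul (by fun_prop) (Complex.continuous_ofReal.comp B.continuous))
      (HasCompactSupport.mul_left (B.hasCompactSupport.comp_left Complex.ofReal_zero))
  have hre : ∫ b, Real.cos (inner ℝ b t₀) * B b = 0 := by
    have h1 := integral_re (𝕜 := ℂ) hI
    rw [fourierInt] at h
    rw [h] at h1
    simp only [RCLike.re_to_complex, Complex.zero_re] at h1
    rw [← h1]
    refine integral_congr_ae (ae_of_all _ fun b => ?_)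
    simp [Complex.exp_ofReal_mul_I_re]
  have hpos : ∀ b, b ∈ Function.support B → 0 < Real.cos (inner ℝ b t₀) := fun b hb => by
    rw [B.support_eq, mem_ball_zero_iff] at hb
    have h1 : |inner ℝ b t₀| ≤ 1 := by
      refine (abs_real_inner_le_norm b t₀).trans ?_
      calc ‖b‖ * ‖t₀‖ ≤ (‖t₀‖ + 1)⁻¹ * (‖t₀‖ + 1) := by
            exact mul_le_mul hb.le (by linarith) (norm_nonneg _) hr.le
        _ = 1 := inv_mul_cancel₀ (by positivity)
    have h2 := abs_le.1 h1
    have := Real.pi_gt_three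
    exact Real.cos_pos_of_mem_Ioo ⟨by linarith, by linarith⟩
  have hnn : ∀ b, 0 ≤ Real.cos (inner ℝ b t₀) * B b := fun b => by
    by_cases hb : b ∈ Function.support B
    · exact mul_nonneg (hpos b hb).le B.nonneg
    · simp [Function.notMem_support.1 hb]
  have hcont : Continuous fun b => Real.cos (inner ℝ b t₀) * B b :=
    Continuous.mul (by fun_prop) B.continuous
  have hp := hcont.integral_pos_of_hasCompactSupport_nonneg_nonzero
    (μ := volume) B.hasCompactSupport.mul_left hnn (x := 0) (by
      have h1 : B 0 = 1 := B.one_of_mem_closedBall (Metric.mem_closedBall_self B.rIn_pos.le)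
      simp [h1])
  linarith

end FourierSide

/-! ### Linear independence of exponential polynomials and of monomials -/

section ExponentialPolynomials

/-- Exponential polynomials with distinct bases are linearly independent over the polynomials. -/
theorem polynomial_eq_zero_of_sum_eval_mul_pow_eq_zero {n : ℕ} (p : Fin n → Polynomial ℂ)
    {z : Fin n → ℂ} (hz : Function.Injective z) (hz0 : ∀ j, z j ≠ 0)
    (h : ∀ m : ℕ, ∑ j, (p j).eval (m : ℂ) * z j ^ m = 0) : ∀ j, p j = 0 := by
  -- For the shift `S`, the operator `S - c` sends `q(m) c^m` to `c (Δq)(m) c^m`. Differences lower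
  -- the degree, so each summand is a generalized eigenvector of `S` for `z j`, and generalized
  -- eigenspaces of distinct eigenvalues are independent.
  let S : Module.End ℂ (ℕ → ℂ) :=
    { toFun := fun u m => u (m + 1)
      map_add' := fun _ _ => rfl
      map_smul' := fun _ _ => rfl }
  have hstep : ∀ (c : ℂ) (q : ℂ → ℂ), (S - c • (1 : Module.End ℂ (ℕ → ℂ))) (fun m => q m * c ^ m) =
      c • fun m : ℕ => fwdDiff 1 q (m : ℂ) * c ^ m := by
    intro c q
    funext m
    simp [S, fwdDiff, pow_succ]
    ring
  have hiter : ∀ (c : ℂ) (r : ℕ) (q : ℂ → ℂ),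
      ((S - c • (1 : Module.End ℂ (ℕ → ℂ))) ^ r) (fun m => q m * c ^ m) =
        c ^ r • fun m : ℕ => (fwdDiff 1)^[r] q (m : ℂ) * c ^ m := by
    intro c r
    induction r with
    | zero => intro q; simp
    | succ r ih =>
      intro q
      rw [pow_succ, Module.End.mul_apply, hstep, map_smul, ih, Function.iterate_succ_apply, smul_smul,
        pow_succ, mul_comm]
  have hmem : ∀ j, (fun m : ℕ => (p j).eval (m : ℂ) * z j ^ m) ∈ S.maxGenEigenspace (z j) := by
    intro j
    rw [Module.End.mem_maxGenEigenspace]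
    refine ⟨(p j).natDegree + 1, ?_⟩
    rw [hiter (z j) _ fun y => (p j).eval y]
    have := Polynomial.fwdDiff_iter_degree_add_one_eq_zero (p j)
    rw [this]
    funext m
    simp
  have hind := (iSupIndep_iff_finsetSum_eq_zero_imp_eq_zero _).1
    (S.independent_maxGenEigenspace.comp hz) Finset.univ
    (fun j m => (p j).eval (m : ℂ) * z j ^ m) (fun j _ => hmem j)
    (by
      funext m
      simpa using h m)
  intro j
  refine Polynomial.eq_zero_of_infinite_isRoot _ ((Set.infinite_range_of_injective
    (Nat.cast_injective (R := ℂ))).mono ?_)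
  rintro _ ⟨m, rfl⟩
  have := congrFun (hind j (Finset.mem_univ j)) m
  exact (mul_eq_zero.1 this).resolve_right (pow_ne_zero _ (hz0 j))

variable {N : ℕ}

/-- Some linear functional is nonzero on the finitely many differences `x i - x j`. Scaling it puts
all phases in `[-1, 1]`, where `exp (i ·)` is injective. -/
theorem exists_exp_inner_injective {n : ℕ} {x : Fin n → EuclideanSpace ℝ (Fin N)}
    (hx : Function.Injective x) : ∃ v : EuclideanSpace ℝ (Fin N),
      Function.Injective fun j => Complex.exp ((inner ℝ (x j) v : ℝ) * Complex.I) := by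
  obtain ⟨g, hg⟩ := Module.exists_dual_forall_apply_ne_zero (K := ℝ)
    (fun q : {q : Fin n × Fin n // q.1 ≠ q.2} => x q.1.1 - x q.1.2)
    fun q => sub_ne_zero.2 fun h => q.2 (hx h)
  let d := (InnerProductSpace.toDual ℝ _).symm (LinearMap.toContinuousLinearMap g)
  have hd : ∀ y, inner ℝ y d = g y := fun y => by
    rw [real_inner_comm]
    simp [d]
  set M : ℝ := 1 + ∑ j, |g (x j)| with hM
  have hM0 : 0 < M := by positivity
  refine ⟨M⁻¹ • d, fun i j hij => ?_⟩
  have hbd : ∀ j, |inner ℝ (x j) (M⁻¹ • d)| ≤ 1 := fun j => by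
    rw [real_inner_smul_right, hd, abs_mul, abs_inv, abs_of_pos hM0, inv_mul_le_iff₀ hM0, mul_one]
    have := Finset.single_le_sum (f := fun j => |g (x j)|) (fun _ _ => abs_nonneg _)
      (Finset.mem_univ j)
    linarith
  have hpi := Real.pi_gt_three
  have hb : ∀ j, -Real.pi < (((inner ℝ (x j) (M⁻¹ • d) : ℝ) : ℂ) * Complex.I).im ∧
      (((inner ℝ (x j) (M⁻¹ • d) : ℝ) : ℂ) * Complex.I).im ≤ Real.pi := fun j => by
    have h1 := abs_le.1 (hbd j)
    simp only [Complex.mul_I_im, Complex.ofReal_re]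
    exact ⟨by linarith, by linarith⟩
  have h1 := Complex.exp_inj_of_neg_pi_lt_of_le_pi (hb i).1 (hb i).2 (hb j).1 (hb j).2 hij
  have h2 : inner ℝ (x i) (M⁻¹ • d) = inner ℝ (x j) (M⁻¹ • d) := by
    exact_mod_cast mul_right_cancel₀ Complex.I_ne_zero h1
  rw [real_inner_smul_right, real_inner_smul_right, hd, hd] at h2
  have h3 := mul_left_cancel₀ (inv_ne_zero hM0.ne') h2
  by_contra hne
  exact hg ⟨(i, j), hne⟩ (by simp [map_sub, h3])

/-- If a trigonometric polynomial with polynomial coefficients vanishes on a non-empty open set,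
then its coefficients vanish. -/
theorem sum_prod_inner_eq_zero_of_isOpen {n : ℕ} {x : Fin n → EuclideanSpace ℝ (Fin N)}
    (hx : Function.Injective x) {A : Type*} [Fintype A] (L : A → List (EuclideanSpace ℝ (Fin N)))
    (w : Fin n → A → ℝ) {U : Set (EuclideanSpace ℝ (Fin N))} (hU : IsOpen U) (hUne : U.Nonempty)
    (h : ∀ t ∈ U, ∑ j, ∑ α, (w j α : ℂ) * (Complex.exp ((inner ℝ (x j) t : ℝ) * Complex.I) *
      ((L α).map fun v => ((inner ℝ v t : ℝ) : ℂ) * Complex.I).prod) = 0) (j : Fin n)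
    (t : EuclideanSpace ℝ (Fin N)) :
    ∑ α, (w j α : ℂ) * ((L α).map fun v => ((inner ℝ v t : ℝ) : ℂ) * Complex.I).prod = 0 := by
  have hlin : ∀ v : EuclideanSpace ℝ (Fin N),
      AnalyticOnNhd ℝ (fun t => ((inner ℝ v t : ℝ) : ℂ) * Complex.I) Set.univ := fun v => by
    have := ((Complex.ofRealCLM.comp (innerSL ℝ v)).smulRight Complex.I).analyticOnNhd Set.univ
    exact this
  have hprod : ∀ l : List (EuclideanSpace ℝ (Fin N)), AnalyticOnNhd ℝ
      (fun t => (l.map fun v => ((inner ℝ v t : ℝ) : ℂ) * Complex.I).prod) Set.univ := by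
    intro l
    induction l with
    | nil => simpa using analyticOnNhd_const
    | cons v l ih => simpa using (hlin v).mul ih
  have hexp : ∀ v : EuclideanSpace ℝ (Fin N),
      AnalyticOnNhd ℝ (fun t => Complex.exp (((inner ℝ v t : ℝ) : ℂ) * Complex.I)) Set.univ :=
    fun v t ht => ((Complex.differentiable_exp.analyticAt _).restrictScalars).comp (hlin v t ht)
  have hQ : AnalyticOnNhd ℝ (fun t => ∑ j, ∑ α, (w j α : ℂ) *
      (Complex.exp ((inner ℝ (x j) t : ℝ) * Complex.I) *
      ((L α).map fun v => ((inner ℝ v t : ℝ) : ℂ) * Complex.I).prod)) Set.univ :=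
    Finset.analyticOnNhd_fun_sum _ fun j _ => Finset.analyticOnNhd_fun_sum _ fun α _ =>
      analyticOnNhd_const.mul ((hexp (x j)).mul (hprod (L α)))
  obtain ⟨t₀, ht₀⟩ := hUne
  have hall := hQ.eq_of_eventuallyEq (g := fun _ => (0 : ℂ)) analyticOnNhd_const
    (z₀ := t₀) (by filter_upwards [hU.mem_nhds ht₀] with t ht using h t ht)
  obtain ⟨v, hv⟩ := exists_exp_inner_injective hx
  -- `p j` is the `j`-th summand along `t + c v`, with the factor `z_j ^ c` split off; its value at
  -- `c = 0` recovers the coefficient at `t`.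
  let p : Fin n → Polynomial ℂ := fun j =>
    Polynomial.C (Complex.exp ((inner ℝ (x j) t : ℝ) * Complex.I)) *
    ∑ α, Polynomial.C (w j α : ℂ) * ((L α).map fun u =>
      Polynomial.C (((inner ℝ u t : ℝ) : ℂ) * Complex.I) +
      Polynomial.C (((inner ℝ u v : ℝ) : ℂ) * Complex.I) * Polynomial.X).prod
  have hp : ∀ (j : Fin n) (c : ℂ), (p j).eval c =
      Complex.exp ((inner ℝ (x j) t : ℝ) * Complex.I) *
      ∑ α, (w j α : ℂ) * ((L α).map fun u => ((inner ℝ u t : ℝ) : ℂ) * Complex.I +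
      ((inner ℝ u v : ℝ) : ℂ) * Complex.I * c).prod := by
    intro j c
    simp only [p, Polynomial.eval_mul, Polynomial.eval_C, Polynomial.eval_finsetSum,
      Polynomial.eval_list_prod, List.map_map]
    congr 1
    refine Finset.sum_congr rfl fun α _ => ?_
    congr 2
    refine List.map_congr_left fun u _ => ?_
    simp
  have hp0 := polynomial_eq_zero_of_sum_eval_mul_pow_eq_zero p hv (fun j => Complex.exp_ne_zero _)
    (by
      intro m
      have h1 := congrFun hall (t + (m : ℝ) • v)
      rw [← h1]
      refine Finset.sum_congr rfl fun j _ => ?_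
      rw [hp, mul_right_comm, ← Complex.exp_nat_mul, ← Complex.exp_add, Finset.mul_sum]
      refine Finset.sum_congr rfl fun α _ => ?_
      rw [mul_left_comm]
      congr 2
      · rw [inner_add_right, real_inner_smul_right]
        congr 1
        push_cast
        ring
      · congr 1
        refine List.map_congr_left fun u _ => ?_
        rw [inner_add_right, real_inner_smul_right]
        push_cast
        ring) j
  have h2 := hp j 0
  rw [hp0, Polynomial.eval_zero] at h2
  have h3 := (mul_eq_zero.1 h2.symm).resolve_left (Complex.exp_ne_zero _)
  simpa using h3

/-- The exponent determines the multiset of indices, and a monotone tuple is the sorted list of its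
multiset. -/
theorem sum_single_injective (k : ℕ) : Function.Injective fun α : DerivIndex N k =>
    ∑ j, Finsupp.single (α.2.1 j) (1 : ℕ) := by
  rintro ⟨⟨l, hl⟩, i, hi⟩ ⟨⟨l', hl'⟩, i', hi'⟩ h
  have key : ∀ {l : ℕ} (i : Fin l → Fin N),
      Finsupp.toMultiset (∑ j, Finsupp.single (i j) (1 : ℕ)) = ↑(List.ofFn i) := by
    intro l
    induction l with
    | zero => intro i; simp
    | succ l ih =>
      intro i
      rw [Fin.sum_univ_succ, map_add, ih, List.ofFn_succ]
      simp
  have h1 := congrArg Finsupp.toMultiset h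
  simp only [key, Multiset.coe_eq_coe] at h1
  have h2 := h1.eq_of_sortedLE hi.sortedLE_ofFn hi'.sortedLE_ofFn
  have h3 := List.ofFn_inj'.1 h2
  cases h3
  rfl

/-- Monomials belonging to distinct partial derivatives are linearly independent. -/
theorem eq_zero_of_sum_mul_prod_inner_single_eq_zero {k : ℕ} (w : DerivIndex N k → ℝ)
    (h : ∀ t : EuclideanSpace ℝ (Fin N), ∑ α, (w α : ℂ) *
      ((List.ofFn fun j => EuclideanSpace.single (α.2.1 j) (1 : ℝ)).map
        fun v => ((inner ℝ v t : ℝ) : ℂ) * Complex.I).prod = 0) : w = 0 := by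
  let P : MvPolynomial (Fin N) ℂ := ∑ α : DerivIndex N k,
    MvPolynomial.monomial (∑ j, Finsupp.single (α.2.1 j) (1 : ℕ))
      ((w α : ℂ) * Complex.I ^ (α.1 : ℕ))
  have hP : P = 0 := by
    -- The identity is known at real points only; a product of infinite sets still determines a
    -- polynomial.
    refine MvPolynomial.funext_set (fun _ => Set.range ((↑) : ℝ → ℂ))
      (fun _ => Set.infinite_range_of_injective Complex.ofReal_injective) fun y hy => ?_
    choose t ht using fun i => hy i (Set.mem_univ i)
    have h1 := h (WithLp.toLp 2 t)
    rw [map_zero, ← h1]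
    simp only [P, map_sum]
    refine Finset.sum_congr rfl fun α _ => ?_
    rw [MvPolynomial.eval_monomial, mul_assoc, List.map_ofFn, List.prod_ofFn]
    congr 1
    have h2 : ((∑ j, Finsupp.single (α.2.1 j) (1 : ℕ)).prod fun n e => y n ^ e) =
        ∏ j, y (α.2.1 j) := by
      rw [← Finsupp.prod_finsetSum_index (fun _ => pow_zero _) fun _ _ _ => pow_add _ _ _]
      simp
    rw [h2]
    simp [Finset.prod_mul_distrib, EuclideanSpace.inner_single_left, ← ht, mul_comm]
  funext α
  have h1 := congrArg (MvPolynomial.coeff (∑ j, Finsupp.single (α.2.1 j) (1 : ℕ))) hP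
  classical
  simp only [P, MvPolynomial.coeff_sum, MvPolynomial.coeff_monomial,
    (sum_single_injective k).eq_iff, MvPolynomial.coeff_zero] at h1
  rw [Finset.sum_ite_eq' Finset.univ α] at h1
  simpa [Complex.I_ne_zero] using h1

end ExponentialPolynomials

/-! ### Stationarity and orthogonality to the covariance function -/

section RandomFunctions

theorem hasCompactSupport_sum {X ι : Type*} [TopologicalSpace X] (s : Finset ι)
    (η : ι → X → ℝ) (h : ∀ i, HasCompactSupport (η i)) :
    HasCompactSupport fun x => ∑ i ∈ s, η i x := by
  classical
  induction s using Finset.induction_on with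
  | empty => exact HasCompactSupport.zero
  | insert i s hi ih =>
    simp only [Finset.sum_insert hi]
    exact (h i).add ih

variable {Ω : Type*} [MeasurableSpace Ω] {P : Measure Ω} {N : ℕ}
  {f : EuclideanSpace ℝ (Fin N) → Ω → ℝ}

theorem IsStationaryRandomFunction.identDistrib_apply (hf : IsStationaryRandomFunction f P)
    (x : EuclideanSpace ℝ (Fin N)) : IdentDistrib (f x) (f 0) P P := by
  have h := (hf x).comp (measurable_pi_apply (0 : EuclideanSpace ℝ (Fin N)))
  simpa [Function.comp_def] using h

/-- Being almost surely equal to `c` depends only on the law of a measurable functional of the path,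
and the functional commutes with translations. -/
theorem IsStationaryRandomFunction.ae_sum_listSeqDeriv_eq (hf : IsStationaryRandomFunction f P)
    {ι : Type*} [Fintype ι] (w : ι → ℝ) (p : ι → EuclideanSpace ℝ (Fin N))
    (L : ι → List (EuclideanSpace ℝ (Fin N))) {c : ℝ}
    (hc : ∀ᵐ ω ∂P, ∑ i, w i * listSeqDeriv (L i) (fun x => f x ω) (p i) = c)
    (a : EuclideanSpace ℝ (Fin N)) :
    ∀ᵐ ω ∂P, ∑ i, w i * listSeqDeriv (L i) (fun x => f x ω) (a + p i) = c := by
  have hΦ : Measurable fun g : EuclideanSpace ℝ (Fin N) → ℝ =>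
      ∑ i, w i * listSeqDeriv (L i) g (p i) :=
    Finset.measurable_fun_sum _ fun i _ =>
      measurable_const.mul ((measurable_pi_apply _).comp (measurable_listSeqDeriv (L i)))
  have h1 := ((hf a).comp hΦ).symm.ae_snd (p := fun y => y = c) (measurableSet_eq) hc
  filter_upwards [h1] with ω hω
  have h2 : ∀ i, listSeqDeriv (L i) (fun x => f (x + a) ω) (p i) =
      listSeqDeriv (L i) (fun x => f x ω) (a + p i) := fun i => by
    rw [add_comm a]
    exact congrFun (listSeqDeriv_comp_add_right a (fun x => f x ω) (L i)) (p i)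
  simpa [Function.comp_def, h2] using hω

theorem integral_mul_sum_comp_sub {g : EuclideanSpace ℝ (Fin N) → ℝ} (hg : Continuous g)
    {ι : Type*} [Fintype ι] (w : ι → ℝ) (p : ι → EuclideanSpace ℝ (Fin N))
    {η : ι → EuclideanSpace ℝ (Fin N) → ℝ} (hη : ∀ i, Continuous (η i))
    (hηc : ∀ i, HasCompactSupport (η i)) :
    ∫ b, g b * ∑ i, w i * η i (b - p i) = ∑ i, w i * ∫ b, g (b + p i) * η i b := by
  have hI : ∀ i, Integrable fun b => g b * (w i * η i (b - p i)) := fun i => by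
    refine (hg.mul (continuous_const.mul ((hη i).comp (continuous_sub_right _)))
      ).integrable_of_hasCompactSupport ?_
    have h1 : HasCompactSupport fun b => η i (b - p i) :=
      (hηc i).comp_homeomorph (Homeomorph.subRight (p i))
    exact (h1.mul_left (f := fun _ => w i)).mul_left
  simp_rw [Finset.mul_sum]
  rw [integral_finsetSum _ fun i _ => hI i]
  refine Finset.sum_congr rfl fun i _ => ?_
  rw [← integral_add_right_eq_self _ (p i), ← integral_const_mul]
  refine integral_congr_ae (ae_of_all _ fun b => ?_)
  simp only [add_sub_cancel_right]
  ring

variable [IsProbabilityMeasure P]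

/-- If the pathwise integral of `f` against `ψ` is almost surely constant, then `ψ` is orthogonal
to the covariance function. -/
theorem integral_covariance_mul_eq_zero_of_ae_integral_eq
    (hmeas : ∀ x, Measurable (f x)) (hL2 : ∀ x, MemLp (f x) 2 P)
    (hf : IsStationaryRandomFunction f P) (hcont : ∀ ω, Continuous fun x => f x ω)
    {ψ : EuclideanSpace ℝ (Fin N) → ℝ} (hψ : Continuous ψ) (hψc : HasCompactSupport ψ) {d : ℝ}
    (hd : ∀ᵐ ω ∂P, ∫ b, f b ω * ψ b = d) (x : EuclideanSpace ℝ (Fin N)) :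
    ∫ b, cov[f x, f b; P] * ψ b = 0 := by
  set m : ℝ := ∫ ω, f 0 ω ∂P with hm
  have hmean : ∀ b, ∫ ω, f b ω ∂P = m := fun b => (hf.identDistrib_apply b).integral_eq
  have hmeasf : Measurable (Function.uncurry f) :=
    measurable_uncurry_of_continuous_of_measurable hcont hmeas
  have hψI : Integrable ψ := hψ.integrable_of_hasCompactSupport hψc
  have hL2' : ∀ b, MemLp (fun ω => f b ω - m) 2 P := fun b => (hL2 b).sub (memLp_const m)
  have hsq : ∀ b, ∫ ω, (f b ω - m) ^ 2 ∂P = ∫ ω, (f 0 ω - m) ^ 2 ∂P := fun b =>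
    ((hf.identDistrib_apply b).comp
      (show Measurable fun y : ℝ => (y - m) ^ 2 by fun_prop)).integral_eq
  have hprod : ∀ b, Integrable (fun ω => (f x ω - m) * (f b ω - m)) P := fun b =>
    (hL2' x).integrable_mul (hL2' b)
  -- The inequality `2uv ≤ u² + v²` and stationarity give a bound uniform in `b`, which makes Fubini
  -- applicable.
  have hbound : ∀ b, ∫ ω, ‖(f x ω - m) * (f b ω - m)‖ ∂P ≤ ∫ ω, (f 0 ω - m) ^ 2 ∂P := by
    intro b
    calc ∫ ω, ‖(f x ω - m) * (f b ω - m)‖ ∂P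
        ≤ ∫ ω, (2⁻¹ * (f x ω - m) ^ 2 + 2⁻¹ * (f b ω - m) ^ 2) ∂P := by
          refine integral_mono (hprod b).norm (((hL2' x).integrable_sq.const_mul _).add
            ((hL2' b).integrable_sq.const_mul _)) fun ω => ?_
          simp only [Real.norm_eq_abs, abs_mul]
          nlinarith [sq_nonneg (|f x ω - m| - |f b ω - m|), sq_abs (f x ω - m),
            sq_abs (f b ω - m)]
      _ = ∫ ω, (f 0 ω - m) ^ 2 ∂P := by
          rw [integral_add ((hL2' x).integrable_sq.const_mul _)
            ((hL2' b).integrable_sq.const_mul _), integral_const_mul, integral_const_mul,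
            hsq x, hsq b]
          ring
  have hmeasF : Measurable fun q : EuclideanSpace ℝ (Fin N) × Ω =>
      (f x q.2 - m) * (f q.1 q.2 - m) * ψ q.1 :=
    ((((hmeas x).comp measurable_snd).sub_const m).mul (hmeasf.sub_const m)).mul
      (hψ.measurable.comp measurable_fst)
  have hI : Integrable (fun q : EuclideanSpace ℝ (Fin N) × Ω =>
      (f x q.2 - m) * (f q.1 q.2 - m) * ψ q.1) (volume.prod P) := by
    rw [integrable_prod_iff hmeasF.aestronglyMeasurable]
    refine ⟨ae_of_all _ fun b => (hprod b).mul_const (ψ b), ?_⟩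
    refine (hψI.norm.const_mul (∫ ω, (f 0 ω - m) ^ 2 ∂P)).mono'
      hmeasF.aestronglyMeasurable.norm.integral_prod_right' (ae_of_all _ fun b => ?_)
    simp only [norm_mul _ (ψ b), integral_mul_const]
    rw [norm_mul, norm_norm, Real.norm_of_nonneg (integral_nonneg fun ω => norm_nonneg _)]
    exact mul_le_mul_of_nonneg_right (hbound b) (norm_nonneg _)
  calc ∫ b, cov[f x, f b; P] * ψ b
      = ∫ b, ∫ ω, (f x ω - m) * (f b ω - m) * ψ b ∂P := by
        simp_rw [covariance, hmean, integral_mul_const]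
    _ = ∫ ω, (∫ b, (f x ω - m) * (f b ω - m) * ψ b) ∂P := integral_integral_swap hI
    _ = ∫ ω, (f x ω - m) * (d - m * ∫ b, ψ b) ∂P := by
        refine integral_congr_ae ?_
        filter_upwards [hd] with ω hω
        simp_rw [mul_assoc]
        rw [integral_const_mul]
        simp_rw [sub_mul _ m (ψ _)]
        rw [integral_sub, hω, integral_const_mul]
        · exact ((hcont ω).mul hψ).integrable_of_hasCompactSupport hψc.mul_left
        · exact hψI.const_mul m
    _ = 0 := by
        rw [integral_mul_const, integral_sub ((hL2 x).integrable (by norm_num))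
          (integrable_const m), hmean]
        simp

/-- The covariance function is orthogonal to the smoothed adjoint of a linear combination of
derivatives that is almost surely constant. -/
theorem integral_covariance_mul_sum_listDerivAdjoint_eq_zero
    (hmeas : ∀ x, Measurable (f x)) (hL2 : ∀ x, MemLp (f x) 2 P)
    (hf : IsStationaryRandomFunction f P)
    (hcont : Continuous fun p : EuclideanSpace ℝ (Fin N) × EuclideanSpace ℝ (Fin N) =>
      cov[f p.1, f p.2; P])
    {k : ℕ} (hdiff : ∀ ω, TimesDifferentiable k fun x => f x ω)
    {ι : Type*} [Fintype ι] (w : ι → ℝ) (p : ι → EuclideanSpace ℝ (Fin N))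
    (L : ι → List (EuclideanSpace ℝ (Fin N))) (hL : ∀ i, (L i).length ≤ k) {c : ℝ}
    (hc : ∀ᵐ ω ∂P, ∑ i, w i * listDeriv (L i) (fun x => f x ω) (p i) = c)
    {φ : EuclideanSpace ℝ (Fin N) → ℝ} (hφ : ContDiff ℝ (⊤ : ℕ∞) φ) (hφc : HasCompactSupport φ)
    (x : EuclideanSpace ℝ (Fin N)) :
    ∫ b, cov[f x, f b; P] * ∑ i, w i * listDerivAdjoint (L i) φ (b - p i) = 0 := by
  have hη : ∀ i, Continuous (listDerivAdjoint (L i) φ) := fun i =>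
    (contDiff_listDerivAdjoint (L i) hφ).continuous
  have hηc : ∀ i, HasCompactSupport (listDerivAdjoint (L i) φ) := fun i =>
    hasCompactSupport_listDerivAdjoint (L i) hφc
  have hseq : ∀ i ω, listSeqDeriv (L i) (fun x => f x ω) = listDeriv (L i) fun x => f x ω :=
    fun i ω => listSeqDeriv_eq_listDeriv (hdiff ω).differentiable_listDeriv _ (hL i)
  have hshift := hf.ae_sum_listSeqDeriv_eq w p L (c := c) (by simpa only [hseq] using hc)
  have hcx : Continuous fun b => cov[f x, f b; P] :=
    hcont.comp (continuous_const.prodMk continuous_id)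
  obtain rfl | hk := eq_or_ne k 0
  -- For `k = 0` the paths have no regularity, so pathwise integrals are not available. The
  -- covariance of `f x` with the constant combination vanishes for each `a`, before any
  -- integration.
  · have hnil : ∀ i, L i = [] := fun i => List.length_eq_zero_iff.1 (Nat.le_zero.1 (hL i))
    rw [integral_mul_sum_comp_sub hcx w p hη hηc]
    simp only [hnil, listDerivAdjoint, listSeqDeriv] at hshift ⊢
    simp_rw [← integral_const_mul]
    have hI : ∀ i, Integrable fun a => w i * (cov[f x, f (a + p i); P] * φ a) := fun i =>
      (((hcx.comp (continuous_add_const (p i))).mul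
        hφ.continuous).integrable_of_hasCompactSupport hφc.mul_left).const_mul (w i)
    rw [← integral_finsetSum _ fun i _ => hI i]
    refine (integral_congr_ae (ae_of_all _ fun a => ?_)).trans (integral_zero _ _)
    have h1 : cov[f x, fun ω => ∑ i, w i * f (a + p i) ω; P] = 0 := by
      have h2 : cov[f x, fun ω => ∑ i, w i * f (a + p i) ω; P] = cov[f x, fun _ => c; P] := by
        have h3 : ∫ ω, ∑ i, w i * f (a + p i) ω ∂P = ∫ ω, c ∂P := integral_congr_ae (hshift a)
        rw [covariance, covariance, h3]
        refine integral_congr_ae ?_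
        filter_upwards [hshift a] with ω hω
        rw [hω]
      rw [h2]
      simp [covariance]
    rw [covariance_fun_sum_right (fun i => (hL2 _).const_mul _) (hL2 x)] at h1
    simp_rw [covariance_const_mul_right] at h1
    calc ∑ i, w i * (cov[f x, f (a + p i); P] * φ a)
        = (∑ i, w i * cov[f x, f (a + p i); P]) * φ a := by
          rw [Finset.sum_mul]
          exact Finset.sum_congr rfl fun i _ => (mul_assoc _ _ _).symm
      _ = 0 := by rw [h1, zero_mul]
  · have hpath : ∀ ω, Continuous fun x => f x ω := fun ω =>
      ((hdiff ω).differentiable_listDeriv [] (Nat.pos_of_ne_zero hk)).continuous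
    have hmeasf : Measurable (Function.uncurry f) :=
      measurable_uncurry_of_continuous_of_measurable hpath hmeas
    have hX : Measurable fun q : EuclideanSpace ℝ (Fin N) × Ω =>
        ∑ i, w i * listSeqDeriv (L i) (fun x => f x q.2) (q.1 + p i) :=
      Finset.measurable_fun_sum _ fun i _ => measurable_const.mul
        ((measurable_uncurry_listSeqDeriv hmeasf (L i)).comp
          ((measurable_fst.add_const _).prodMk measurable_snd))
    have hae : ∀ᵐ ω ∂P, ∀ᵐ a, ∑ i, w i * listSeqDeriv (L i) (fun x => f x ω) (a + p i) = c :=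
      (Measure.ae_ae_comm (p := fun a ω =>
        ∑ i, w i * listSeqDeriv (L i) (fun x => f x ω) (a + p i) = c)
        (hX (measurableSet_singleton c))).1 (ae_of_all _ hshift)
    refine integral_covariance_mul_eq_zero_of_ae_integral_eq hmeas hL2 hf hpath
      (ψ := fun b => ∑ i, w i * listDerivAdjoint (L i) φ (b - p i))
      (continuous_finsetSum _ fun i _ => continuous_const.mul
        ((hη i).comp (continuous_sub_right _))) ?_ (d := c * ∫ b, φ b) ?_ x
    · have h1 : ∀ i, HasCompactSupport fun b => w i * listDerivAdjoint (L i) φ (b - p i) :=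
        fun i => ((hηc i).comp_homeomorph (Homeomorph.subRight (p i))).mul_left
          (f := fun _ => w i)
      exact hasCompactSupport_sum _ _ h1
    · filter_upwards [hae] with ω hω
      rw [integral_mul_sum_comp_sub (hpath ω) w p hη hηc]
      simp only [hseq] at hω
      exact sum_integral_listDerivAdjoint_eq hk (hdiff ω) w p L hL hω hφ hφc

end RandomFunctions

/-! ### Conclusion -/

section StrictPositiveDefiniteness

variable {Ω : Type*} {N : ℕ} {f : EuclideanSpace ℝ (Fin N) → Ω → ℝ}

theorem dotProduct_derivVector_eq {k n : ℕ} {ω : Ω} (hω : TimesDifferentiable k fun x => f x ω)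
    (x : Fin n → EuclideanSpace ℝ (Fin N)) (w : Fin n → DerivIndex N k → ℝ) :
    ∑ j, w j ⬝ᵥ derivVector k f (x j) ω = ∑ i : Fin n × DerivIndex N k, w i.1 i.2 *
      listDeriv (List.ofFn fun l => EuclideanSpace.single (i.2.2.1 l) (1 : ℝ))
        (fun y => f y ω) (x i.1) := by
  rw [Fintype.sum_prod_type]
  refine Finset.sum_congr rfl fun j _ => Finset.sum_congr rfl fun α _ => ?_
  rw [← iteratedFDeriv_apply_eq_listDeriv hω _ (Nat.lt_succ_iff.1 α.1.2)]
  rfl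

variable [MeasurableSpace Ω] {P : Measure Ω} [IsProbabilityMeasure P]

/-- The case of a random function all of whose paths are differentiable. -/
theorem strictlyPositiveDefinite_derivVector_of_forall
    (hmeas : ∀ x, Measurable (f x)) (hL2 : ∀ x, MemLp (f x) 2 P)
    (hstat : IsStationaryRandomFunction f P)
    (hcont : Continuous fun p : EuclideanSpace ℝ (Fin N) × EuclideanSpace ℝ (Fin N) =>
      cov[f p.1, f p.2; P])
    {σ : Measure (EuclideanSpace ℝ (Fin N))} (hσ : IsSpectralMeasure σ f P)
    {U : Set (EuclideanSpace ℝ (Fin N))} (hU : IsOpen U) (hUne : U.Nonempty) (hUσ : U ⊆ σ.support)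
    {k : ℕ} (hdiff : ∀ ω, TimesDifferentiable k fun x => f x ω) :
    StrictlyPositiveDefinite (derivVector k f) P := by
  intro n x hx w hw
  have := hσ.finite
  let L : Fin n × DerivIndex N k → List (EuclideanSpace ℝ (Fin N)) := fun i =>
    List.ofFn fun l => EuclideanSpace.single (i.2.2.1 l) (1 : ℝ)
  have hL : ∀ i, (L i).length ≤ k := fun i => by
    simpa [L] using Nat.lt_succ_iff.1 i.2.1.2
  have hX : ∀ ω, ∑ j, w j ⬝ᵥ derivVector k f (x j) ω = ∑ i : Fin n × DerivIndex N k,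
      w i.1 i.2 * listDeriv (L i) (fun y => f y ω) (x i.1) := fun ω =>
    dotProduct_derivVector_eq (hdiff ω) x w
  simp_rw [hX] at hw
  have hXm : Measurable fun ω => ∑ i : Fin n × DerivIndex N k,
      w i.1 i.2 * listDeriv (L i) (fun y => f y ω) (x i.1) := by
    refine Finset.measurable_fun_sum _ fun i _ => measurable_const.mul ?_
    simp_rw [← fun ω => listSeqDeriv_eq_listDeriv (hdiff ω).differentiable_listDeriv _ (hL i)]
    exact (measurable_pi_apply _).comp ((measurable_listSeqDeriv (L i)).comp
      (measurable_pi_lambda _ hmeas))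
  -- No moment of the combination is needed: zero extended variance makes it almost surely equal to
  -- its Bochner integral, which serves as the constant `c`.
  rw [evariance_eq_zero_iff hXm.aemeasurable] at hw
  -- The Fourier integral of the smoothed adjoint is `Q(t)` times that of `φ`.
  have hψ0 : ∀ φ : EuclideanSpace ℝ (Fin N) → ℝ, ContDiff ℝ (⊤ : ℕ∞) φ → HasCompactSupport φ →
      ∀ t ∈ σ.support, (∑ j, ∑ α, (w j α : ℂ) * (Complex.exp ((inner ℝ (x j) t : ℝ) * Complex.I) *
        ((L (j, α)).map fun v => ((inner ℝ v t : ℝ) : ℂ) * Complex.I).prod)) *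
        fourierInt φ t = 0 := by
    intro φ hφ hφc t ht
    have hη : ∀ i, Continuous (listDerivAdjoint (L i) φ) := fun i =>
      (contDiff_listDerivAdjoint (L i) hφ).continuous
    have hηI : ∀ i, Integrable fun b => w i.1 i.2 * listDerivAdjoint (L i) φ (b - x i.1) :=
      fun i => (((hη i).integrable_of_hasCompactSupport
        (hasCompactSupport_listDerivAdjoint (L i) hφc)).comp_sub_right (x i.1)).const_mul _
    have h1 := fourierInt_eq_zero_of_mem_support (σ := σ)
      (ψ := fun b => ∑ i, w i.1 i.2 * listDerivAdjoint (L i) φ (b - x i.1))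
      (integrable_finsetSum _ fun i _ => hηI i)
      (fun y => by
        have h2 := integral_covariance_mul_sum_listDerivAdjoint_eq_zero hmeas hL2 hstat hcont
          hdiff (fun i : Fin n × DerivIndex N k => w i.1 i.2) (fun i => x i.1) L hL hw hφ hφc y
        rw [← Complex.ofReal_zero, ← h2, ← integral_complex_ofReal]
        refine integral_congr_ae (ae_of_all _ fun b => ?_)
        simp only [Complex.ofReal_mul, hσ.covariance_eq]) t ht
    rw [← h1, ← Fintype.sum_prod_type' (f := fun j α => (w j α : ℂ) *
      (Complex.exp ((inner ℝ (x j) t : ℝ) * Complex.I) *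
        ((L (j, α)).map fun v => ((inner ℝ v t : ℝ) : ℂ) * Complex.I).prod)), Finset.sum_mul]
    conv_rhs => rw [fourierInt]
    simp_rw [Complex.ofReal_sum, Finset.mul_sum]
    rw [integral_finsetSum]
    · refine Finset.sum_congr rfl fun i _ => ?_
      simp_rw [Complex.ofReal_mul, mul_left_comm _ (w i.1 i.2 : ℂ)]
      rw [integral_const_mul]
      change _ = _ * fourierInt (fun b => listDerivAdjoint (L i) φ (b - x i.1)) t
      rw [fourierInt_comp_sub_right, fourierInt_listDerivAdjoint t (L i) hφ hφc]
      ring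
    · intro i _
      refine (hηI i).ofReal.bdd_mul (c := 1) (Continuous.aestronglyMeasurable (by fun_prop))
        (ae_of_all _ fun b => (norm_exp_inner_mul_I b t).le)
  intro j
  refine eq_zero_of_sum_mul_prod_inner_single_eq_zero (w j) fun t => ?_
  refine sum_prod_inner_eq_zero_of_isOpen hx (fun α => L (j, α)) w hU hUne (fun t ht => ?_) j t
  obtain ⟨φ, hφ, hφc, hφt⟩ := exists_fourierInt_ne_zero t
  exact (mul_eq_zero.1 (hψ0 φ hφ hφc t (hUσ ht))).resolve_right hφt

end StrictPositiveDefiniteness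

/-- Replacing `f` by zero on a measurable null set containing the exceptional paths makes every path
differentiable and preserves laws, covariances and the variance in question. -/
theorem mainTheorem3 {Ω : Type*} [MeasurableSpace Ω] (P : Measure Ω) [IsProbabilityMeasure P]
    (N : ℕ) (f : EuclideanSpace ℝ (Fin N) → Ω → ℝ)
    (hmeas : ∀ x, Measurable (f x)) (hL2 : ∀ x, MemLp (f x) 2 P)
    (hstat : IsStationaryRandomFunction f P)
    (hcont : Continuous fun p : EuclideanSpace ℝ (Fin N) × EuclideanSpace ℝ (Fin N) =>
      cov[f p.1, f p.2; P])
    (σ : Measure (EuclideanSpace ℝ (Fin N))) (hσ : IsSpectralMeasure σ f P)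
    (hsupp : ∃ U : Set (EuclideanSpace ℝ (Fin N)), IsOpen U ∧ U.Nonempty ∧ U ⊆ σ.support)
    (k : ℕ) (hdiff : ∀ᵐ ω ∂P, TimesDifferentiable k fun x => f x ω) :
    StrictlyPositiveDefinite (derivVector k f) P := by
  classical
  obtain ⟨U, hU, hUne, hUσ⟩ := hsupp
  obtain ⟨A, hAsub, hAm, hA0⟩ := exists_measurable_superset_of_null hdiff
  let g : EuclideanSpace ℝ (Fin N) → Ω → ℝ := fun x => Aᶜ.indicator (f x)
  have hgA : ∀ ω ∈ Aᶜ, ∀ x, g x ω = f x ω := fun ω hω x => Set.indicator_of_mem hω _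
  have hAae : ∀ᵐ ω ∂P, ω ∈ Aᶜ := compl_mem_ae_iff.2 hA0
  have hgf : ∀ x, g x =ᵐ[P] f x := fun x => by
    filter_upwards [hAae] with ω hω using hgA ω hω x
  have hgm : ∀ x, Measurable (g x) := fun x => (hmeas x).indicator hAm.compl
  have hcov : ∀ x y, cov[g x, g y; P] = cov[f x, f y; P] := fun x y => by
    rw [covariance, covariance, integral_congr_ae (hgf x), integral_congr_ae (hgf y)]
    refine integral_congr_ae ?_
    filter_upwards [hgf x, hgf y] with ω h1 h2
    rw [h1, h2]
  have hshift : ∀ a, IdentDistrib (fun ω x => g (x + a) ω) (fun ω x => f (x + a) ω) P P :=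
    fun a => IdentDistrib.of_ae_eq
      (measurable_pi_lambda _ fun x => hgm (x + a)).aemeasurable
      (by filter_upwards [hAae] with ω hω using funext fun x => hgA ω hω (x + a))
  have hgstat : IsStationaryRandomFunction g P := fun a => by
    have h0 := hshift 0
    simp only [add_zero] at h0
    exact ((hshift a).trans (hstat a)).trans h0.symm
  have hgdiff : ∀ ω, TimesDifferentiable k fun x => g x ω := fun ω => by
    by_cases hω : ω ∈ A
    · have h0 : (fun x => g x ω) = fun _ => 0 :=
        funext fun x => Set.indicator_of_notMem (by simpa using hω) _
      rw [h0]
      intro m _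
      exact (contDiff_const (n := (⊤ : ℕ∞))).differentiable_iteratedFDeriv
        (by exact_mod_cast WithTop.coe_lt_top m)
    · have h0 : (fun x => g x ω) = fun x => f x ω := funext fun x => hgA ω hω x
      rw [h0]
      by_contra h
      exact hω (hAsub h)
  have hmain : StrictlyPositiveDefinite (derivVector k g) P :=
    strictlyPositiveDefinite_derivVector_of_forall hgm
      (fun x => (memLp_congr_ae (hgf x)).2 (hL2 x)) hgstat (by simpa only [hcov] using hcont)
      ⟨hσ.finite, fun x y => by rw [hcov, hσ.covariance_eq]⟩ hU hUne hUσ hgdiff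
  intro n x hx w hw
  refine hmain n x hx w ((evariance_congr ?_).trans hw)
  filter_upwards [hAae] with ω hω
  have h0 : (fun x => g x ω) = fun x => f x ω := funext fun x => hgA ω hω x
  refine Finset.sum_congr rfl fun j _ => congrArg (w j ⬝ᵥ ·) (funext fun α => ?_)
  change partialDeriv _ (fun y => g y ω) _ = partialDeriv _ (fun y => f y ω) _
  rw [h0]
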